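/- Let $(R,\mathfrak m,k)$ be a commutative Noetherian local domain of Krull dimension $2$ which is analytically normal, i.e. whose $\mathfrak m$-adic completion $\widehat R$ is a normal domain. Let $I$ be a nonzero ideal of $R$ which is reflexive as an $R$-module (the natural map $I\to I^{**}$ is an isomorphism) and has finite injective dimension over $R$. Then $I$ is isomorphic to the canonical module of $R$: that is, $R$ has a canonical module isomorphic to $I$, and every canonical module of $R$ is isomorphic to $I$. Here a canonical module of $R$ is a maximal Cohen–Macaulay $R$-module $\omega$ (nonzero, finitely generated, with $\operatorname{depth}\omega=\dim R$) of finite injective dimension and of type one, i.e. $\dim_k \operatorname{Ext}^{\operatorname{depth}\omega}_R(k,\omega)=1$. -/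

import Mathlib

open CategoryTheory

universe u

/-- A Noetherian local ring `R` is analytically normal if its completion at the maximal ideal is a
normal domain. -/
def IsAnalyticallyNormal (R : Type u) [CommRing R] [IsLocalRing R] : Prop :=
  IsDomain (AdicCompletion (IsLocalRing.maximalIdeal R) R) ∧
    IsIntegrallyClosed (AdicCompletion (IsLocalRing.maximalIdeal R) R)

/-- The depth of a module over a local ring: the supremum of the lengths of the `M`-regular
sequences contained in the maximal ideal. -/
noncomputable def localDepth (R : Type u) [CommRing R] [IsLocalRing R]
    (M : Type u) [AddCommGroup M] [Module R M] : ℕ∞ :=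
  ⨆ rs : {rs : List R // (∀ r ∈ rs, r ∈ IsLocalRing.maximalIdeal R) ∧
    RingTheory.Sequence.IsRegular M rs}, (rs.1.length : ℕ∞)

/-- A maximal Cohen-Macaulay module over a Noetherian local ring: a nonzero finitely generated
module whose depth is the Krull dimension of the ring. -/
structure IsMaximalCohenMacaulay (R : Type u) [CommRing R] [IsLocalRing R]
    (M : Type u) [AddCommGroup M] [Module R M] : Prop where
  finite : Module.Finite R M
  nontrivial : Nontrivial M
  depth_eq : (localDepth R M : WithBot ℕ∞) = ringKrullDim R

/-- The type of a nonzero finitely generated module `M` over a Noetherian local ring with residue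
field `k`, i.e. the dimension over `k` of `Ext^t(k, M)` with `t = depth M`. As this module is
annihilated by the maximal ideal, its `k`-dimension is its length over `R`. -/
noncomputable def cohenMacaulayType (R : Type u) [CommRing R] [IsLocalRing R]
    (M : Type u) [AddCommGroup M] [Module R M] : ℕ∞ :=
  Module.length R (Abelian.Ext.{u} (ModuleCat.of R (IsLocalRing.ResidueField R))
    (ModuleCat.of R M) (localDepth R M).toNat)

/-- A canonical module of a Noetherian local ring: a maximal Cohen-Macaulay module of type one and
of finite injective dimension. -/
structure IsCanonicalModule (R : Type u) [CommRing R] [IsLocalRing R]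
    (M : Type u) [AddCommGroup M] [Module R M] : Prop where
  isMaximalCohenMacaulay : IsMaximalCohenMacaulay R M
  type_eq_one : cohenMacaulayType R M = 1
  injectiveDimension_lt_top : injectiveDimension (ModuleCat.of R M) < ⊤

/-!
The argument avoids injective hulls and Matlis duality, and works with `Ext` modules from modules of
finite length. The completion only serves to show that `R` is normal
(`IsAnalyticallyNormal.isIntegrallyClosed`). Then `R`, and with it every reflexive module, has depth
at least two, so `I` is maximal Cohen-Macaulay; the same argument shows that `R / I` has positive
depth.

*The type.* Let `N` be a finitely generated module of depth two and finite injective dimension, and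
let `x, y` be a sequence in `𝔪` that is regular on `R` and on `N`. As `k` embeds in `R / (x, y)`,
which has projective dimension two, `Extⁱ k N` vanishes for `i > 2`. It also vanishes for `i < 2`,
so `Ext² (-) N` is exact on modules of finite length and multiplies the length by the type of `N`.
Applied to `R / (x, y)`, for which `Ext²` is `N / (x, y)N`, this gives
`length (N / (x, y)N) = type N * length (R / (x, y))`
(`length_quotSMulTop_quotSMulTop_eq_mul`). For `N = I`, choose `x` in `I`. The kernel and the
cokernel of `I / xI → R / xR` are both isomorphic to `R / I`, and hence `I / (x, y)I` and
`R / (x, y)` have equal length for a suitable `y` (`length_quotSMulTop_quotSMulTop_ideal`). So `I`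
has type one.

*Uniqueness.* Let `M` and `N` be of depth two, finite injective dimension and type one. The modules
`M / (x, y)M` and `N / (x, y)N` have simple socle and equal length. For `T` killed by `x` and `y`,
`Hom(T, N / (x, y)N)` is naturally `Ext² T N`, and so `Ext³ (-) N = 0` allows an isomorphism of the
socles to be extended to a map `M / (x, y)M → N / (x, y)N`, which is then bijective. It lifts to a
map `M → N`, since `Ext¹ M N` and `Ext² M N` vanish by Nakayama's lemma, and the lift is surjective,
again by Nakayama. With surjections in both directions, `M` and `N` are isomorphic
(`nonempty_linearEquiv_of_length_ext_two_eq_one`).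
-/

open Abelian IsLocalRing
open scoped Pointwise

/-! ### `Ext` and multiplication by a regular element -/

section RegularElement

variable {R : Type u} [CommRing R] {T N : Type u} [AddCommGroup T] [Module R T]
  [AddCommGroup N] [Module R N] {x : R}

/-- A linear map `f : T → T'`, as a map of `Ext` modules in the first variable. -/
noncomputable abbrev extPrecomp {T' : Type u} [AddCommGroup T'] [Module R T'] (f : T →ₗ[R] T')
    (n : ℕ) :
    Ext.{u} (ModuleCat.of R T') (ModuleCat.of R N) n →ₗ[R]
      Ext.{u} (ModuleCat.of R T) (ModuleCat.of R N) n :=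
  (Ext.mk₀ (ModuleCat.ofHom f)).precompOfLinear R _ (zero_add n)

theorem mk₀_smul_id_comp {n : ℕ} (e : Ext.{u} (ModuleCat.of R T) (ModuleCat.of R N) n) :
    (Ext.mk₀ (x • 𝟙 (ModuleCat.of R T))).comp e (zero_add n) = x • e := by
  rw [Ext.mk₀_smul, Ext.smul_comp, Ext.mk₀_id_comp]

theorem smul_ext_eq_zero {n : ℕ} (hT : ∀ t : T, x • t = 0)
    (e : Ext.{u} (ModuleCat.of R T) (ModuleCat.of R N) n) : x • e = 0 := by
  have h : x • 𝟙 (ModuleCat.of R T) = 0 := by ext t; exact hT t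
  rw [← mk₀_smul_id_comp, h, Ext.mk₀_zero, Ext.zero_comp]

/-- The connecting homomorphism `Ext T (N / xN) n → Ext T N (n + 1)` of `0 → N → N → N / xN → 0`. -/
noncomputable def extConnecting (T : Type u) [AddCommGroup T] [Module R T]
    (hx : IsSMulRegular N x) (n : ℕ) :
    Ext.{u} (ModuleCat.of R T) (ModuleCat.of R (QuotSMulTop x N)) n →ₗ[R]
      Ext.{u} (ModuleCat.of R T) (ModuleCat.of R N) (n + 1) :=
  (IsSMulRegular.smulShortComplex_shortExact (M := ModuleCat.of R N) hx).extClass.postcompOfLinear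
    R _ rfl

theorem extConnecting_extPrecomp {T' : Type u} [AddCommGroup T'] [Module R T'] (f : T →ₗ[R] T')
    (hx : IsSMulRegular N x) (n : ℕ)
    (e : Ext.{u} (ModuleCat.of R T') (ModuleCat.of R (QuotSMulTop x N)) n) :
    extConnecting T hx n (extPrecomp f n e) = extPrecomp f (n + 1) (extConnecting T' hx n e) :=
  Ext.comp_assoc _ _ _ (zero_add n) rfl (by lia)

theorem extConnecting_injective (hx : IsSMulRegular N x) {n : ℕ}
    (h : Subsingleton (Ext.{u} (ModuleCat.of R T) (ModuleCat.of R N) n)) :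
    Function.Injective (extConnecting T hx n) := by
  refine (injective_iff_map_eq_zero _).2 fun e he ↦ ?_
  obtain ⟨e', rfl⟩ := Ext.covariant_sequence_exact₃ _
    (IsSMulRegular.smulShortComplex_shortExact (M := ModuleCat.of R N) hx) e rfl he
  rw [show e' = 0 from h.elim _ _]
  exact Ext.zero_comp ..

/-- The cokernel of the connecting homomorphism embeds in `x • Ext`, which vanishes. -/
theorem extConnecting_surjective (hx : IsSMulRegular N x) (n : ℕ) (hT : ∀ t : T, x • t = 0) :
    Function.Surjective (extConnecting T hx n) := by
  intro e
  refine Ext.covariant_sequence_exact₁ _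
    (IsSMulRegular.smulShortComplex_shortExact (M := ModuleCat.of R N) hx) e ?_ rfl
  rw [ModuleCat.smulShortComplex_f_eq_smul_id]
  exact (Ext.smul_eq_comp_mk₀ e x).symm.trans (smul_ext_eq_zero hT e)

theorem exists_mkQ_comp_eq (hx : IsSMulRegular N x)
    (h : Subsingleton (Ext.{u} (ModuleCat.of R T) (ModuleCat.of R N) 1))
    (φ : T →ₗ[R] QuotSMulTop x N) : ∃ ψ : T →ₗ[R] N, (x • (⊤ : Submodule R N)).mkQ ∘ₗ ψ = φ := by
  obtain ⟨e, he⟩ := Ext.covariant_sequence_exact₃ _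
    (IsSMulRegular.smulShortComplex_shortExact (M := ModuleCat.of R N) hx)
    (Ext.mk₀ (ModuleCat.ofHom φ)) (zero_add 1) (h.elim _ _)
  obtain ⟨ψ, rfl⟩ := (Ext.mk₀_bijective _ _).2 e
  rw [Ext.mk₀_comp_mk₀] at he
  exact ⟨ψ.hom, congrArg ModuleCat.Hom.hom ((Ext.mk₀_bijective _ _).1 he)⟩

theorem subsingleton_ext_quotSMulTop_right (hx : IsSMulRegular N x) {n : ℕ}
    (h : Subsingleton (Ext.{u} (ModuleCat.of R T) (ModuleCat.of R N) n))
    (h' : Subsingleton (Ext.{u} (ModuleCat.of R T) (ModuleCat.of R N) (n + 1))) :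
    Subsingleton (Ext.{u} (ModuleCat.of R T) (ModuleCat.of R (QuotSMulTop x N)) n) :=
  (extConnecting_injective hx h).subsingleton

theorem subsingleton_ext_quotSMulTop_left (hx : IsSMulRegular T x) {n : ℕ}
    (h : Subsingleton (Ext.{u} (ModuleCat.of R T) (ModuleCat.of R N) n))
    (h' : Subsingleton (Ext.{u} (ModuleCat.of R T) (ModuleCat.of R N) (n + 1))) :
    Subsingleton (Ext.{u} (ModuleCat.of R (QuotSMulTop x T)) (ModuleCat.of R N) (n + 1)) := by
  refine subsingleton_of_forall_eq 0 fun e ↦ ?_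
  obtain ⟨e', rfl⟩ := Ext.contravariant_sequence_exact₃
    (IsSMulRegular.smulShortComplex_shortExact (M := ModuleCat.of R T) hx) _ e
    (h'.elim _ _) (n₀ := n) (by lia)
  rw [show e' = 0 from h.elim _ _]
  exact Ext.comp_zero ..

/-- Multiplication by `x` is surjective on the finitely generated module `Ext T N n`, which is
therefore zero by Nakayama's lemma. -/
theorem subsingleton_ext_of_quotSMulTop_left [IsLocalRing R] [IsNoetherianRing R]
    [Module.Finite R T] [Module.Finite R N] (hx : IsSMulRegular T x)
    (hxm : x ∈ maximalIdeal R) {n : ℕ}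
    (h : Subsingleton (Ext.{u} (ModuleCat.of R (QuotSMulTop x T)) (ModuleCat.of R N) (n + 1))) :
    Subsingleton (Ext.{u} (ModuleCat.of R T) (ModuleCat.of R N) n) := by
  have hsurj (e : Ext.{u} (ModuleCat.of R T) (ModuleCat.of R N) n) : ∃ e', x • e' = e := by
    obtain ⟨e', he'⟩ := Ext.contravariant_sequence_exact₁
      (IsSMulRegular.smulShortComplex_shortExact (M := ModuleCat.of R T) hx) _ e
      (n₁ := n + 1) (by lia) (h.elim _ _)
    exact ⟨e', (mk₀_smul_id_comp (T := T) e').symm.trans he'⟩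
  rw [← Submodule.subsingleton_iff R, ← subsingleton_iff_bot_eq_top]
  refine (Submodule.eq_bot_of_le_smul_of_le_jacobson_bot (maximalIdeal R) _
    (Module.finite_def.1 inferInstance) ?_ (maximalIdeal_le_jacobson _)).symm
  intro e _
  obtain ⟨e', rfl⟩ := hsurj e
  exact Submodule.smul_mem_smul hxm trivial

end RegularElement

/-! ### `Ext` along a short exact sequence in the first variable -/

section ShortExact

variable {R : Type u} [CommRing R] {A B C : Type u} [AddCommGroup A] [Module R A]
  [AddCommGroup B] [Module R B] [AddCommGroup C] [Module R C] {f : A →ₗ[R] B} {g : B →ₗ[R] C}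
  {N : Type u} [AddCommGroup N] [Module R N]

theorem shortExact_of_linearMap (hf : Function.Injective f) (hg : Function.Surjective g)
    (hfg : Function.Exact f g) :
    (ModuleCat.shortComplexOfCompEqZero f g hfg.linearMap_comp_eq_zero).ShortExact :=
  ModuleCat.shortComplex_shortExact _ hfg hf hg

theorem extPrecomp_exact (hf : Function.Injective f) (hg : Function.Surjective g)
    (hfg : Function.Exact f g) (n : ℕ) :
    Function.Exact (extPrecomp (N := N) g n) (extPrecomp (N := N) f n) := by
  intro e
  refine ⟨fun he ↦ Ext.contravariant_sequence_exact₂ (shortExact_of_linearMap hf hg hfg) _ e he, ?_⟩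
  rintro ⟨e, rfl⟩
  exact (Ext.mk₀_comp_mk₀_assoc _ _ e).trans <| by
    rw [← ModuleCat.ofHom_comp, hfg.linearMap_comp_eq_zero, ModuleCat.ofHom_zero, Ext.mk₀_zero,
      Ext.zero_comp]

theorem extPrecomp_surjective (hf : Function.Injective f) (hg : Function.Surjective g)
    (hfg : Function.Exact f g) {n : ℕ}
    (h : Subsingleton (Ext.{u} (ModuleCat.of R C) (ModuleCat.of R N) (n + 1))) :
    Function.Surjective (extPrecomp (N := N) f n) := fun e ↦
  Ext.contravariant_sequence_exact₁ (shortExact_of_linearMap hf hg hfg) _ e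
    (n₁ := n + 1) (by lia) (h.elim _ _)

theorem extPrecomp_injective (hf : Function.Injective f) (hg : Function.Surjective g)
    (hfg : Function.Exact f g) {n : ℕ}
    (h : Subsingleton (Ext.{u} (ModuleCat.of R A) (ModuleCat.of R N) n)) :
    Function.Injective (extPrecomp (N := N) g (n + 1)) := by
  refine (injective_iff_map_eq_zero _).2 fun e he ↦ ?_
  obtain ⟨e', rfl⟩ := Ext.contravariant_sequence_exact₃ (shortExact_of_linearMap hf hg hfg) _ e he
    (n₀ := n) (by lia)
  rw [show e' = 0 from h.elim _ _, Ext.comp_zero]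

theorem subsingleton_ext_of_exact (hf : Function.Injective f) (hg : Function.Surjective g)
    (hfg : Function.Exact f g) {n : ℕ}
    (hA : Subsingleton (Ext.{u} (ModuleCat.of R A) (ModuleCat.of R N) n))
    (hC : Subsingleton (Ext.{u} (ModuleCat.of R C) (ModuleCat.of R N) n)) :
    Subsingleton (Ext.{u} (ModuleCat.of R B) (ModuleCat.of R N) n) := by
  refine subsingleton_of_forall_eq 0 fun e ↦ ?_
  obtain ⟨e', rfl⟩ := (extPrecomp_exact hf hg hfg n e).1 (hA.elim _ _)
  rw [show e' = 0 from hC.elim _ _, map_zero]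

theorem subsingleton_ext_of_subsingleton [Subsingleton A] {n : ℕ} :
    Subsingleton (Ext.{u} (ModuleCat.of R A) (ModuleCat.of R N) n) := by
  refine subsingleton_of_forall_eq 0 fun e ↦ ?_
  rw [← Ext.mk₀_id_comp e, (ModuleCat.isZero_of_subsingleton (ModuleCat.of R A)).eq_of_src
    (𝟙 (ModuleCat.of R A)) 0, Ext.mk₀_zero, Ext.zero_comp]

/-- An isomorphism `e : A ≃ B` induces an isomorphism of `Ext` modules. -/
noncomputable def extCongrLeft (e : A ≃ₗ[R] B) (n : ℕ) :
    Ext.{u} (ModuleCat.of R B) (ModuleCat.of R N) n ≃ₗ[R]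
      Ext.{u} (ModuleCat.of R A) (ModuleCat.of R N) n :=
  LinearEquiv.ofLinearMap (extPrecomp e.toLinearMap n) (extPrecomp e.symm.toLinearMap n)
    (LinearMap.ext fun a ↦ (Ext.mk₀_comp_mk₀_assoc _ _ a).trans <| by
      rw [← ModuleCat.ofHom_comp, LinearEquiv.symm_comp]; exact Ext.mk₀_id_comp a)
    (LinearMap.ext fun a ↦ (Ext.mk₀_comp_mk₀_assoc _ _ a).trans <| by
      rw [← ModuleCat.ofHom_comp, LinearEquiv.comp_symm]; exact Ext.mk₀_id_comp a)

/-- `Ext` in degree zero is `Hom`. -/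
noncomputable def extZeroEquiv :
    Ext.{u} (ModuleCat.of R A) (ModuleCat.of R N) 0 ≃ₗ[R] (A →ₗ[R] N) :=
  Ext.linearEquiv₀.trans ModuleCat.homLinearEquiv

theorem extZeroEquiv_symm_comp (φ : B →ₗ[R] N) :
    extZeroEquiv.symm (φ ∘ₗ f) = extPrecomp f 0 (extZeroEquiv.symm φ) :=
  (Ext.mk₀_comp_mk₀ (ModuleCat.ofHom f) (ModuleCat.ofHom φ)).symm

end ShortExact

/-! ### `Ext` from modules of finite length -/

section FiniteLength

variable {R : Type u} [CommRing R] [IsLocalRing R] {T N : Type u} [AddCommGroup T] [Module R T]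
  [AddCommGroup N] [Module R N]

theorem nonempty_linearEquiv_residueField_of_isSimpleModule (S : Type*) [AddCommGroup S]
    [Module R S] [IsSimpleModule R S] : Nonempty (S ≃ₗ[R] ResidueField R) := by
  obtain ⟨m, hm, ⟨e⟩⟩ := isSimpleModule_iff_quot_maximal.1 ‹IsSimpleModule R S›
  rw [eq_maximalIdeal hm] at e
  exact ⟨e⟩

theorem exists_injective_residueField [Nontrivial T] (hT : IsFiniteLength R T) :
    ∃ f : ResidueField R →ₗ[R] T, Function.Injective f := by
  have := (isFiniteLength_iff_isNoetherian_isArtinian.1 hT).2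
  obtain ⟨S, hS⟩ := IsAtomic.exists_atom (Submodule R T)
  have := isSimpleModule_iff_isAtom.2 hS
  obtain ⟨e⟩ := nonempty_linearEquiv_residueField_of_isSimpleModule (R := R) S
  exact ⟨S.subtype ∘ₗ e.symm.toLinearMap, S.injective_subtype.comp e.symm.injective⟩

theorem subsingleton_ext_of_isFiniteLength {n : ℕ}
    (hk : Subsingleton (Ext.{u} (ModuleCat.of R (ResidueField R)) (ModuleCat.of R N) n))
    (hT : IsFiniteLength R T) :
    Subsingleton (Ext.{u} (ModuleCat.of R T) (ModuleCat.of R N) n) := by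
  induction hT with
  | @of_subsingleton T _ _ _ =>
    exact subsingleton_ext_of_subsingleton
  | @of_simple_quotient T _ _ S _ _ ih =>
    obtain ⟨e⟩ := nonempty_linearEquiv_residueField_of_isSimpleModule (R := R) (T ⧸ S)
    exact subsingleton_ext_of_exact S.injective_subtype S.mkQ_surjective
      (LinearMap.exact_subtype_mkQ S) ih (extCongrLeft e n).symm.injective.subsingleton

/-- The exact functor `Ext (-) N (n + 1)` on modules of finite length multiplies the length by a
constant. -/
theorem length_ext_of_isFiniteLength {n : ℕ}
    (h₀ : Subsingleton (Ext.{u} (ModuleCat.of R (ResidueField R)) (ModuleCat.of R N) n))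
    (h₂ : Subsingleton (Ext.{u} (ModuleCat.of R (ResidueField R)) (ModuleCat.of R N) (n + 2)))
    (hT : IsFiniteLength R T) :
    Module.length R (Ext.{u} (ModuleCat.of R T) (ModuleCat.of R N) (n + 1)) =
      Module.length R T * Module.length R
        (Ext.{u} (ModuleCat.of R (ResidueField R)) (ModuleCat.of R N) (n + 1)) := by
  induction hT with
  | @of_subsingleton T _ _ _ =>
    have := subsingleton_ext_of_subsingleton (R := R) (A := T) (N := N) (n := n + 1)
    simp
  | @of_simple_quotient T _ _ S _ hS ih =>
    obtain ⟨e⟩ := nonempty_linearEquiv_residueField_of_isSimpleModule (R := R) (T ⧸ S)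
    have hex := LinearMap.exact_subtype_mkQ S
    have hlen : Module.length R (T ⧸ S) = 1 := Module.length_eq_one R _
    rw [Module.length_eq_add_of_exact _ _
      (extPrecomp_injective S.injective_subtype S.mkQ_surjective hex
        (subsingleton_ext_of_isFiniteLength h₀ hS))
      (extPrecomp_surjective S.injective_subtype S.mkQ_surjective hex
        (extCongrLeft e (n + 2)).symm.injective.subsingleton)
      (extPrecomp_exact S.injective_subtype S.mkQ_surjective hex (n + 1)), ih,
      Module.length_eq_add_of_exact _ _ S.injective_subtype S.mkQ_surjective hex,
      ← (extCongrLeft e (n + 1)).length_eq, hlen, add_mul, one_mul, add_comm]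

/-- If `N` has finite injective dimension, the vanishing of `Ext C N i` in degrees `i ≥ d` for a
single nonzero module `C` of finite length forces that of `Ext k N i`: as `k` embeds in `C`, the
highest nonzero `Ext k N i` is a quotient of `Ext C N i`. -/
theorem subsingleton_ext_residueField_of_injectiveDimension_lt_top
    (hN : injectiveDimension (ModuleCat.of R N) < ⊤) {C : Type u} [AddCommGroup C] [Module R C]
    [Nontrivial C] (hC : IsFiniteLength R C) {d : ℕ}
    (h : ∀ i, d ≤ i → Subsingleton (Ext.{u} (ModuleCat.of R C) (ModuleCat.of R N) i)) (i : ℕ)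
    (hi : d ≤ i) :
    Subsingleton (Ext.{u} (ModuleCat.of R (ResidueField R)) (ModuleCat.of R N) i) := by
  obtain ⟨n, hn⟩ := (injectiveDimension_ne_top_iff _).1 hN.ne
  obtain ⟨f, hf⟩ := exists_injective_residueField hC
  suffices H : ∀ j i, d ≤ i → n + 1 ≤ i + j →
      Subsingleton (Ext.{u} (ModuleCat.of R (ResidueField R)) (ModuleCat.of R N) i) from
    H (n + 1) i hi (by lia)
  intro j
  induction j with
  | zero => exact fun i _ hi ↦ HasInjectiveDimensionLT.subsingleton _ (n + 1) i hi _
  | succ j ih =>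
    intro i hi hij
    have := h i hi
    exact (extPrecomp_surjective hf (LinearMap.range f).mkQ_surjective
      (LinearMap.exact_map_mkQ_range f) (subsingleton_ext_of_isFiniteLength
        (ih (i + 1) (by lia) (by lia))
        (hC.of_surjective (Submodule.mkQ_surjective _)))).subsingleton

end FiniteLength

/-! ### Reduction modulo a regular sequence of length two -/

section RegularPair

variable {R : Type u} [CommRing R] {T N : Type u} [AddCommGroup T] [Module R T]
  [AddCommGroup N] [Module R N] {x y : R}

/-- For an `N`-regular sequence `x, y`, the composite of connecting homomorphisms
`Hom(T, N / (x, y)N) → Ext¹(T, N / xN) → Ext²(T, N)`. -/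
noncomputable def homToExtTwo (T : Type u) [AddCommGroup T] [Module R T]
    (hx : IsSMulRegular N x) (hy : IsSMulRegular (QuotSMulTop x N) y) :
    (T →ₗ[R] QuotSMulTop y (QuotSMulTop x N)) →ₗ[R]
      Ext.{u} (ModuleCat.of R T) (ModuleCat.of R N) 2 :=
  extConnecting T hx 1 ∘ₗ extConnecting T hy 0 ∘ₗ extZeroEquiv.symm.toLinearMap

theorem homToExtTwo_comp {T' : Type u} [AddCommGroup T'] [Module R T'] (f : T →ₗ[R] T')
    (hx : IsSMulRegular N x) (hy : IsSMulRegular (QuotSMulTop x N) y)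
    (φ : T' →ₗ[R] QuotSMulTop y (QuotSMulTop x N)) :
    homToExtTwo T hx hy (φ ∘ₗ f) = extPrecomp f 2 (homToExtTwo T' hx hy φ) := by
  simp only [homToExtTwo, LinearMap.comp_apply, LinearEquiv.coe_coe]
  rw [extZeroEquiv_symm_comp, extConnecting_extPrecomp, extConnecting_extPrecomp]

theorem homToExtTwo_injective (hx : IsSMulRegular N x) (hy : IsSMulRegular (QuotSMulTop x N) y)
    (h₀ : Subsingleton (Ext.{u} (ModuleCat.of R T) (ModuleCat.of R N) 0))
    (h₁ : Subsingleton (Ext.{u} (ModuleCat.of R T) (ModuleCat.of R N) 1)) :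
    Function.Injective (homToExtTwo T hx hy) :=
  (extConnecting_injective hx h₁).comp ((extConnecting_injective hy
    (subsingleton_ext_quotSMulTop_right hx h₀ h₁)).comp extZeroEquiv.symm.injective)

theorem homToExtTwo_surjective (hx : IsSMulRegular N x) (hy : IsSMulRegular (QuotSMulTop x N) y)
    (hTx : ∀ t : T, x • t = 0) (hTy : ∀ t : T, y • t = 0) :
    Function.Surjective (homToExtTwo T hx hy) :=
  (extConnecting_surjective hx 1 hTx).comp ((extConnecting_surjective hy 0 hTy).comp
    extZeroEquiv.symm.surjective)

theorem smul_quotSMulTop_eq_zero (x : R) (t : QuotSMulTop x T) : x • t = 0 := by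
  induction t using Submodule.Quotient.induction_on with
  | _ t =>
    exact (Submodule.Quotient.mk_eq_zero _).2 (Submodule.smul_mem_pointwise_smul _ _ _ trivial)

theorem smul_quotSMulTop_quotSMulTop_eq_zero (x y : R) (t : QuotSMulTop y (QuotSMulTop x T)) :
    x • t = 0 := by
  induction t using Submodule.Quotient.induction_on with
  | _ t => rw [← Submodule.Quotient.mk_smul, smul_quotSMulTop_eq_zero, Submodule.Quotient.mk_zero]

/-- A linear map `T → N` into a module killed by `x` factors through `T / xT`. -/
def QuotSMulTop.lift (f : T →ₗ[R] N) (hN : ∀ n : N, x • n = 0) : QuotSMulTop x T →ₗ[R] N :=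
  Submodule.liftQ _ f <| by
    rintro _ ⟨t, -, rfl⟩
    exact (f.map_smul x t).trans (hN _)

/-- If `x` and `y` kill `N`, then `Hom(R / (x, y), N) ≃ N`. -/
noncomputable def homQuotSMulTopEquiv (hNx : ∀ n : N, x • n = 0) (hNy : ∀ n : N, y • n = 0) :
    (QuotSMulTop y (QuotSMulTop x R) →ₗ[R] N) ≃ₗ[R] N :=
  LinearEquiv.ofBijective
    (LinearMap.applyₗ (Submodule.Quotient.mk (Submodule.Quotient.mk (1 : R))))
    ⟨by
      refine (injective_iff_map_eq_zero _).2 fun φ hφ ↦ ?_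
      ext
      exact hφ, fun n ↦
      ⟨QuotSMulTop.lift (QuotSMulTop.lift (LinearMap.toSpanSingleton R N n) hNx) hNy,
        one_smul R n⟩⟩

end RegularPair

/-! ### Analytically normal local domains are normal -/

section Completion

variable {R : Type u} [CommRing R] [IsLocalRing R] [IsNoetherianRing R]

/-- Contracting a principal ideal from the completion gives it back, as ideals of a Noetherian
local ring are closed in the adic topology. -/
theorem dvd_of_algebraMap_adicCompletion_dvd {a b : R}
    (h : algebraMap R (AdicCompletion (maximalIdeal R) R) b ∣
      algebraMap R (AdicCompletion (maximalIdeal R) R) a) : b ∣ a := by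
  obtain ⟨c, hc⟩ := h
  rw [← Ideal.mem_span_singleton, ← Ideal.Quotient.eq_zero_iff_mem, ← Submodule.mem_bot (R := R),
    ← Ideal.iInf_pow_smul_eq_bot_of_isLocalRing (M := R ⧸ Ideal.span {b}) (maximalIdeal R)
      (Ideal.IsPrime.ne_top inferInstance), Submodule.mem_iInf]
  intro n
  obtain ⟨r, hr⟩ := Submodule.Quotient.mk_surjective _ (AdicCompletion.eval (maximalIdeal R) R n c)
  have hmem : a - b * r ∈ maximalIdeal R ^ n := by
    have := congrArg (AdicCompletion.eval (maximalIdeal R) R n) hc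
    rw [← smul_eq_mul, algebraMap_smul, map_smul, ← hr] at this
    simpa using (Submodule.Quotient.eq _).1 this
  have : Ideal.Quotient.mk (Ideal.span {b}) a = (a - b * r) • (1 : R ⧸ Ideal.span {b}) := by
    rw [Algebra.smul_def, mul_one, Ideal.Quotient.algebraMap_eq, Ideal.Quotient.eq]
    simpa using Ideal.mul_mem_right r _ (Ideal.mem_span_singleton_self b)
  rw [this]
  exact Submodule.smul_mem_smul hmem trivial

theorem IsAnalyticallyNormal.isIntegrallyClosed [IsDomain R] (h : IsAnalyticallyNormal R) :
    IsIntegrallyClosed R := by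
  obtain ⟨_, _⟩ := h
  set S := AdicCompletion (maximalIdeal R) R
  have hinj : Function.Injective (algebraMap R S) := by
    refine (injective_iff_map_eq_zero _).2 fun a ha ↦ ?_
    exact zero_dvd_iff.1 (dvd_of_algebraMap_adicCompletion_dvd (by rw [ha]; exact dvd_zero _))
  have hinj' : Function.Injective (algebraMap R (FractionRing S)) := by
    rw [IsScalarTower.algebraMap_eq R S]
    exact (IsFractionRing.injective S (FractionRing S)).comp hinj
  refine (isIntegrallyClosed_iff (FractionRing R)).2 fun {z} hz ↦ ?_
  obtain ⟨a, b, hb, rfl⟩ := IsFractionRing.div_surjective (A := R) z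
  let j : FractionRing R →ₐ[R] FractionRing S :=
    IsFractionRing.liftAlgHom (g := Algebra.ofId _ _) hinj'
  obtain ⟨c, hc⟩ := (isIntegrallyClosed_iff (FractionRing S)).1 ‹_› ((hz.map j).tower_top (A := S))
  have hb0 : b ≠ 0 := nonZeroDivisors.ne_zero hb
  have hb' : algebraMap R (FractionRing S) b ≠ 0 := by
    rwa [Ne, map_eq_zero_iff _ hinj']
  rw [map_div₀, AlgHom.commutes, AlgHom.commutes, eq_div_iff hb',
    IsScalarTower.algebraMap_apply R S, IsScalarTower.algebraMap_apply R S, ← map_mul] at hc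
  obtain ⟨d, rfl⟩ := dvd_of_algebraMap_adicCompletion_dvd (a := a) (b := b)
    ⟨c, (mul_comm _ _).trans (IsFractionRing.injective S (FractionRing S) hc) |>.symm⟩
  refine ⟨d, ?_⟩
  rw [map_mul, mul_div_cancel_left₀]
  rwa [Ne, map_eq_zero_iff _ (IsFractionRing.injective R (FractionRing R))]

end Completion

/-! ### Depth two of reflexive modules over normal domains -/

section Socle

variable {R : Type u} [CommRing R] [IsLocalRing R] {M : Type u} [AddCommGroup M] [Module R M]

/-- `Hom(k, M)` is the socle of `M`. -/
theorem subsingleton_residueField_linearMap_iff :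
    Subsingleton (ResidueField R →ₗ[R] M) ↔
      ∀ n : M, (∀ t ∈ maximalIdeal R, t • n = 0) → n = 0 := by
  refine ⟨fun h n hn ↦ ?_, fun h ↦ subsingleton_of_forall_eq 0 fun f ↦ ?_⟩
  · let f : ResidueField R →ₗ[R] M :=
      Submodule.liftQ (maximalIdeal R) (LinearMap.toSpanSingleton R M n) fun t ht ↦ hn t ht
    have : f (residue R 1) = 0 := by rw [h.elim f 0, LinearMap.zero_apply]
    exact (one_smul R n).symm.trans this
  · ext a
    refine h _ fun t ht ↦ ?_
    rw [← map_smul, Algebra.smul_def, ResidueField.algebraMap_eq, (residue_eq_zero_iff t).2 ht,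
      zero_mul, map_zero]

theorem subsingleton_residueField_linearMap_of_isSMulRegular {x : R} (hx : IsSMulRegular M x)
    (hxm : x ∈ maximalIdeal R) : Subsingleton (ResidueField R →ₗ[R] M) :=
  subsingleton_residueField_linearMap_iff.2 fun _ hn ↦ hx.right_eq_zero_of_smul (hn x hxm)

theorem subsingleton_residueField_linearMap_prod {M' : Type u} [AddCommGroup M'] [Module R M']
    (h : Subsingleton (ResidueField R →ₗ[R] M)) (h' : Subsingleton (ResidueField R →ₗ[R] M')) :
    Subsingleton (ResidueField R →ₗ[R] M × M') :=
  subsingleton_of_forall_eq 0 fun f ↦ LinearMap.ext fun a ↦ Prod.ext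
    (LinearMap.congr_fun (h.elim (LinearMap.fst R M M' ∘ₗ f) 0) a)
    (LinearMap.congr_fun (h'.elim (LinearMap.snd R M M' ∘ₗ f) 0) a)

theorem exists_isSMulRegular_of_subsingleton_residueField_linearMap [IsNoetherianRing R]
    [Module.Finite R M] (h : Subsingleton (ResidueField R →ₗ[R] M)) :
    ∃ y ∈ maximalIdeal R, IsSMulRegular M y := by
  obtain ⟨y, hy, hreg⟩ := IsSMulRegular.subsingleton_linearMap_iff.1 h
  refine ⟨y, (residue_eq_zero_iff y).1 ?_, hreg⟩
  have := Module.mem_annihilator.1 hy 1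
  rwa [Algebra.smul_def, mul_one] at this

variable [IsDomain R]

/-- In a normal Noetherian local domain of dimension at least two, `𝔪` is not associated to a
principal ideal. Otherwise some fraction `z = a / x` outside `R` satisfies `z𝔪 ⊆ R`; either
`z𝔪 ⊆ 𝔪`, and `z` is integral, or `z𝔪 = R`, and `𝔪` is principal. -/
theorem subsingleton_residueField_linearMap_quotSMulTop_self [IsNoetherianRing R]
    [IsIntegrallyClosed R] (hdim : 1 < ringKrullDim R) {x : R} (hx : x ≠ 0) :
    Subsingleton (ResidueField R →ₗ[R] QuotSMulTop x R) := by
  refine subsingleton_residueField_linearMap_iff.2 fun a ↦ ?_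
  induction a using Submodule.Quotient.induction_on with | _ a
  intro ha
  replace ha (t : R) (ht : t ∈ maximalIdeal R) : ∃ w, x * w = t * a := by
    have := ha t ht
    rw [← Submodule.Quotient.mk_smul, Submodule.Quotient.mk_eq_zero] at this
    obtain ⟨w, -, hw⟩ := this
    exact ⟨w, hw⟩
  suffices ∃ w, x * w = a from (Submodule.Quotient.mk_eq_zero _).2 (by
    obtain ⟨w, rfl⟩ := this
    exact Submodule.smul_mem_pointwise_smul _ _ _ trivial)
  by_cases hunit : ∃ t ∈ maximalIdeal R, ∃ w, IsUnit w ∧ x * w = t * a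
  · exfalso
    obtain ⟨t, ht, w, hw, hwt⟩ := hunit
    -- Here `t * (a / x)` is the unit `w`, so every `s ∈ 𝔪` is a multiple of `t`.
    have hspan : maximalIdeal R = Ideal.span {t} := by
      refine le_antisymm (fun s hs ↦ ?_) ((Ideal.span_singleton_le_iff_mem _).2 ht)
      obtain ⟨v, hv⟩ := ha s hs
      have : w * s = t * v := mul_left_cancel₀ hx (by linear_combination s * hwt - t * hv)
      rw [Ideal.mem_span_singleton, ← hw.dvd_mul_left, this]
      exact dvd_mul_right t v
    have hp : (maximalIdeal R).IsPrincipal := ⟨t, hspan⟩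
    have := (maximalIdeal R).height_le_one_of_isPrincipal_of_mem_minimalPrimes (maximalIdeal R)
      (by rw [Ideal.minimalPrimes_eq_subsingleton_self]; rfl)
    rw [← maximalIdeal_height_eq_ringKrullDim] at hdim
    exact absurd hdim (not_lt.2 (by exact_mod_cast this))
  · let K := FractionRing R
    have hxK : algebraMap R K x ≠ 0 := by
      rwa [Ne, map_eq_zero_iff _ (IsFractionRing.injective R K)]
    have hm0 : maximalIdeal R ≠ ⊥ := by
      intro h0
      rw [← maximalIdeal_height_eq_ringKrullDim, h0, Ideal.height_bot] at hdim
      exact absurd hdim (by decide)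
    -- Here `a / x` stabilizes the nonzero finitely generated submodule `𝔪` of `K`.
    have hint : IsIntegral R (algebraMap R K a / algebraMap R K x) := by
      refine isIntegral_of_smul_mem_submodule
        (Submodule.map (Algebra.linearMap R K) (maximalIdeal R)) ?_
        ((IsNoetherian.noetherian (maximalIdeal R)).map _) _ ?_
      · exact fun h0 ↦ hm0 (Submodule.map_injective_of_injective
          (f := Algebra.linearMap R K) (IsFractionRing.injective R K)
          (h0.trans (Submodule.map_bot _).symm))
      · rintro _ ⟨t, ht, rfl⟩
        obtain ⟨w, hw⟩ := ha t ht
        refine ⟨w, (mem_maximalIdeal w).2 fun hu ↦ hunit ⟨t, ht, w, hu, hw⟩, ?_⟩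
        rw [smul_eq_mul, Algebra.linearMap_apply, Algebra.linearMap_apply, div_mul_eq_mul_div,
          eq_div_iff hxK, ← map_mul, ← map_mul, mul_comm w, hw, mul_comm]
    obtain ⟨w, hw⟩ := (isIntegrallyClosed_iff K).1 ‹_› hint
    refine ⟨w, IsFractionRing.injective R K ?_⟩
    rw [map_mul, hw, mul_div_cancel₀ _ hxK]

/-- If `𝔪` multiplies `a : M` into `xM`, then `x` divides `f a` for every functional `f`, as `𝔪` is
not associated to `R / xR`. So `f ↦ f a / x` is a functional on the dual, and by reflexivity it is
the evaluation at some `c : M`, for which `a = x • c`. -/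
theorem subsingleton_residueField_linearMap_quotSMulTop_of_isReflexive [Module.IsReflexive R M]
    {x : R} (hx : x ≠ 0) (h : Subsingleton (ResidueField R →ₗ[R] QuotSMulTop x R)) :
    Subsingleton (ResidueField R →ₗ[R] QuotSMulTop x M) := by
  refine subsingleton_residueField_linearMap_iff.2 fun a ↦ ?_
  induction a using Submodule.Quotient.induction_on with | _ a
  intro ha
  have hdiv (f : Module.Dual R M) : ∃ w, x * w = f a := by
    have := subsingleton_residueField_linearMap_iff.1 h
      (QuotSMulTop.map x f (Submodule.Quotient.mk a))
      fun t ht ↦ by rw [← map_smul, ha t ht, map_zero]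
    obtain ⟨w, -, hw⟩ := (Submodule.Quotient.mk_eq_zero _).1 this
    exact ⟨w, hw⟩
  choose g hg using hdiv
  let Φ : Module.Dual R (Module.Dual R M) :=
    { toFun := g
      map_add' := fun f f' ↦ mul_left_cancel₀ hx (by rw [mul_add, hg, hg, hg, LinearMap.add_apply])
      map_smul' := fun r f ↦ mul_left_cancel₀ hx (by
        rw [hg, LinearMap.smul_apply, ← hg f]; simp only [smul_eq_mul, RingHom.id_apply]; ring) }
  obtain ⟨c, hc⟩ := (Module.bijective_dual_eval R M).2 Φ
  have : x • c = a := (Module.bijective_dual_eval R M).1 <| LinearMap.ext fun f ↦ by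
    rw [map_smul, hc, LinearMap.smul_apply]
    exact hg f
  rw [← this]
  exact (Submodule.Quotient.mk_eq_zero _).2 (Submodule.smul_mem_pointwise_smul _ _ _ trivial)

/-- If `𝔪` multiplies `b` into `I`, then it multiplies `b * x : I` into `xI`. -/
theorem subsingleton_residueField_linearMap_quotient_ideal {I : Ideal R} {x : R} (hx : x ≠ 0)
    (hxI : x ∈ I) (h : Subsingleton (ResidueField R →ₗ[R] QuotSMulTop x I)) :
    Subsingleton (ResidueField R →ₗ[R] R ⧸ I) := by
  refine subsingleton_residueField_linearMap_iff.2 fun b ↦ ?_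
  induction b using Submodule.Quotient.induction_on with | _ b
  intro hb
  have hmem : b • (⟨x, hxI⟩ : I) ∈ x • (⊤ : Submodule R I) := by
    refine (Submodule.Quotient.mk_eq_zero _).1 (subsingleton_residueField_linearMap_iff.1 h _
      fun t ht ↦ (Submodule.Quotient.mk_eq_zero _).2 ⟨⟨t * b, ?_⟩, trivial, Subtype.ext ?_⟩)
    · have := hb t ht
      rwa [← Submodule.Quotient.mk_smul, Submodule.Quotient.mk_eq_zero] at this
    · change x * (t * b) = t * (b * x)
      ring
  obtain ⟨i, -, hi⟩ := hmem
  have : b = i := mul_left_cancel₀ hx <| by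
    rw [mul_comm]; exact (congrArg Subtype.val hi).symm
  exact (Submodule.Quotient.mk_eq_zero _).2 (this ▸ i.2)

end Socle

/-! ### The length of the reduction of an ideal -/

section Length

variable {R : Type u} [CommRing R] {A B C : Type u} [AddCommGroup A] [Module R A]
  [AddCommGroup B] [Module R B] [AddCommGroup C] [Module R C] {y : R}

theorem IsSMulRegular.of_prod_left (h : IsSMulRegular (A × B) y) : IsSMulRegular A y :=
  fun a b hab ↦
  (Prod.ext_iff.1 (h (a₁ := (a, 0)) (a₂ := (b, 0)) (Prod.ext hab rfl))).1

theorem IsSMulRegular.of_prod_right (h : IsSMulRegular (A × B) y) : IsSMulRegular B y :=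
  fun a b hab ↦
  (Prod.ext_iff.1 (h (a₁ := (0, a)) (a₂ := (0, b)) (Prod.ext rfl hab))).2

/-- As `y` is regular on `C`, reduction modulo `y` keeps the sequence exact. -/
theorem length_quotSMulTop_eq_add {f : A →ₗ[R] B} {g : B →ₗ[R] C} (hf : Function.Injective f)
    (hg : Function.Surjective g) (hfg : Function.Exact f g) (hy : IsSMulRegular C y) :
    Module.length R (QuotSMulTop y B) =
      Module.length R (QuotSMulTop y A) + Module.length R (QuotSMulTop y C) := by
  refine Module.length_eq_add_of_exact (QuotSMulTop.map y f) (QuotSMulTop.map y g) ?_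
    (QuotSMulTop.map_surjective y hg) (QuotSMulTop.map_exact y hfg hg)
  have h0 : Function.Exact (0 : PUnit.{u + 1} →ₗ[R] A) f := fun a ↦
    ⟨fun ha ↦ ⟨0, (hf (ha.trans (map_zero f).symm)).symm⟩, by rintro ⟨_, rfl⟩; simp⟩
  have := QuotSMulTop.map_first_exact_on_four_term_exact_of_isSMulRegular_last h0 hfg hy
  rw [map_zero] at this
  refine (injective_iff_map_eq_zero _).2 fun a ha ↦ ?_
  obtain ⟨_, rfl⟩ := (this a).1 ha
  rfl

theorem length_quotSMulTop_eq_of_ker_equiv_coker (f : A →ₗ[R] B)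
    (e : LinearMap.ker f ≃ₗ[R] B ⧸ LinearMap.range f) (hy : IsSMulRegular B y)
    (hy' : IsSMulRegular (B ⧸ LinearMap.range f) y) :
    Module.length R (QuotSMulTop y A) = Module.length R (QuotSMulTop y B) := by
  rw [length_quotSMulTop_eq_add (LinearMap.ker f).injective_subtype f.surjective_rangeRestrict
      (f.ker_rangeRestrict ▸ LinearMap.exact_subtype_ker_map f.rangeRestrict) (hy.submodule _ _),
    length_quotSMulTop_eq_add (LinearMap.range f).injective_subtype (Submodule.mkQ_surjective _)
      (LinearMap.exact_subtype_mkQ _) hy', (QuotSMulTop.congr y e).length_eq, add_comm]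

/-- The kernel and the cokernel of `I / xI → R / xR` are both isomorphic to `R / I`, so that the
two modules have the same length modulo `y`. -/
theorem length_quotSMulTop_quotSMulTop_ideal [IsDomain R] {I : Ideal R} {x : R} (hx : x ≠ 0)
    (hxI : x ∈ I) (hy : IsSMulRegular (QuotSMulTop x R) y) (hy' : IsSMulRegular (R ⧸ I) y) :
    Module.length R (QuotSMulTop y (QuotSMulTop x I)) =
      Module.length R (QuotSMulTop y (QuotSMulTop x R)) := by
  let φ : QuotSMulTop x I →ₗ[R] QuotSMulTop x R := QuotSMulTop.map x I.subtype
  -- The cokernel of `φ` is `R / I`, because `xR ⊆ I`.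
  let p : R →ₗ[R] QuotSMulTop x R ⧸ LinearMap.range φ :=
    (LinearMap.range φ).mkQ ∘ₗ (x • (⊤ : Submodule R R)).mkQ
  have hp : LinearMap.ker p = I := by
    ext r
    simp only [p, LinearMap.mem_ker, LinearMap.comp_apply, Submodule.mkQ_apply,
      Submodule.Quotient.mk_eq_zero]
    constructor
    · rintro ⟨i, hi⟩
      induction i using Submodule.Quotient.induction_on with | _ i
      obtain ⟨s, -, hs⟩ := (Submodule.Quotient.eq _).1 hi
      have hs : x * s = i - r := hs
      rw [show r = i - x * s by rw [hs]; ring]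
      exact I.sub_mem i.2 (I.mul_mem_right _ hxI)
    · exact fun hr ↦ ⟨Submodule.Quotient.mk ⟨r, hr⟩, rfl⟩
  -- The kernel `xR / xI` of `φ` is the image of `R / I` under multiplication by `x`.
  let q₀ : R →ₗ[R] QuotSMulTop x I :=
    (x • (⊤ : Submodule R I)).mkQ ∘ₗ LinearMap.toSpanSingleton R I ⟨x, hxI⟩
  let q : R →ₗ[R] LinearMap.ker φ := q₀.codRestrict _ fun r ↦
    (Submodule.Quotient.mk_eq_zero _).2 ⟨r, trivial, mul_comm _ _⟩
  have hq : LinearMap.ker q = I := by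
    ext r
    rw [show LinearMap.ker q = LinearMap.ker q₀ from LinearMap.ker_codRestrict ..,
      LinearMap.mem_ker]
    refine (Submodule.Quotient.mk_eq_zero _).trans ⟨?_, fun hr ↦ ⟨⟨r, hr⟩, trivial, ?_⟩⟩
    · rintro ⟨i, -, hi⟩
      have : x * i = r * x := congrArg Subtype.val hi
      rw [mul_left_cancel₀ hx ((mul_comm x r).trans this.symm)]
      exact i.2
    · exact Subtype.ext (mul_comm _ _)
  have hqs : Function.Surjective q := by
    rintro ⟨i, hi⟩
    induction i using Submodule.Quotient.induction_on with | _ i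
    obtain ⟨r, -, hr⟩ := (Submodule.Quotient.mk_eq_zero _).1 hi
    have hr : x * r = i := hr
    refine ⟨r, Subtype.ext (congrArg Submodule.Quotient.mk (Subtype.ext ?_))⟩
    exact (mul_comm _ _).trans hr
  let e₁ : (R ⧸ I) ≃ₗ[R] QuotSMulTop x R ⧸ LinearMap.range φ :=
    (Submodule.quotEquivOfEq _ _ hp.symm).trans (p.quotKerEquivOfSurjective
      ((Submodule.mkQ_surjective _).comp (Submodule.mkQ_surjective _)))
  let e₂ : (R ⧸ I) ≃ₗ[R] LinearMap.ker φ :=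
    (Submodule.quotEquivOfEq _ _ hq.symm).trans (q.quotKerEquivOfSurjective hqs)
  exact length_quotSMulTop_eq_of_ker_equiv_coker φ (e₂.symm.trans e₁) hy
    ((e₁.isSMulRegular_congr y).1 hy')

end Length

/-! ### Depth at least two -/

section DepthTwo

variable {R : Type u} [CommRing R] [IsLocalRing R]

/-- A module `M` over a local ring with residue field `k` such that `Hom(k, M)` and `Ext¹(k, M)`
vanish. For a finitely generated `M` over a Noetherian ring this says that `M` has depth at
least two. -/
structure HasDepthGETwo (R : Type u) [CommRing R] [IsLocalRing R]
    (M : Type u) [AddCommGroup M] [Module R M] : Prop where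
  subsingleton_hom : Subsingleton (ResidueField R →ₗ[R] M)
  subsingleton_ext_one :
    Subsingleton (Ext.{u} (ModuleCat.of R (ResidueField R)) (ModuleCat.of R M) 1)

variable {M N : Type u} [AddCommGroup M] [Module R M] [AddCommGroup N] [Module R N] {x y : R}

theorem smul_residueField_eq_zero (hx : x ∈ maximalIdeal R) (a : ResidueField R) : x • a = 0 := by
  rw [Algebra.smul_def, ResidueField.algebraMap_eq, (residue_eq_zero_iff x).2 hx, zero_mul]

theorem HasDepthGETwo.subsingleton_ext_zero (h : HasDepthGETwo R M) :
    Subsingleton (Ext.{u} (ModuleCat.of R (ResidueField R)) (ModuleCat.of R M) 0) :=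
  have := h.subsingleton_hom
  extZeroEquiv.injective.subsingleton

theorem HasDepthGETwo.of_quotSMulTop (hx : IsSMulRegular M x) (hxm : x ∈ maximalIdeal R)
    (h : Subsingleton (ResidueField R →ₗ[R] QuotSMulTop x M)) : HasDepthGETwo R M where
  subsingleton_hom := subsingleton_residueField_linearMap_of_isSMulRegular hx hxm
  subsingleton_ext_one :=
    have : Subsingleton (Ext.{u} (ModuleCat.of R (ResidueField R))
      (ModuleCat.of R (QuotSMulTop x M)) 0) := extZeroEquiv.injective.subsingleton
    (extConnecting_surjective hx 0 (smul_residueField_eq_zero hxm)).subsingleton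

theorem HasDepthGETwo.of_isSMulRegular (hx : IsSMulRegular M x) (hxm : x ∈ maximalIdeal R)
    (hy : IsSMulRegular (QuotSMulTop x M) y) (hym : y ∈ maximalIdeal R) : HasDepthGETwo R M :=
  .of_quotSMulTop hx hxm (subsingleton_residueField_linearMap_of_isSMulRegular hy hym)

theorem HasDepthGETwo.subsingleton_hom_quotSMulTop (h : HasDepthGETwo R M)
    (hx : IsSMulRegular M x) : Subsingleton (ResidueField R →ₗ[R] QuotSMulTop x M) :=
  have := (subsingleton_ext_quotSMulTop_right hx h.subsingleton_ext_zero h.subsingleton_ext_one)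
  extZeroEquiv.symm.injective.subsingleton

/-- Prime avoidance for the three modules at once, applied to their product. -/
theorem HasDepthGETwo.exists_isSMulRegular [IsNoetherianRing R] [Module.Finite R M]
    [Module.Finite R N] (hR : HasDepthGETwo R R) (hM : HasDepthGETwo R M)
    (hN : HasDepthGETwo R N) :
    ∃ x ∈ maximalIdeal R, ∃ y ∈ maximalIdeal R,
      (IsSMulRegular R x ∧ IsSMulRegular (QuotSMulTop x R) y) ∧
      (IsSMulRegular M x ∧ IsSMulRegular (QuotSMulTop x M) y) ∧
      (IsSMulRegular N x ∧ IsSMulRegular (QuotSMulTop x N) y) := by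
  obtain ⟨x, hxm, hx⟩ := exists_isSMulRegular_of_subsingleton_residueField_linearMap
    (subsingleton_residueField_linearMap_prod hR.subsingleton_hom
      (subsingleton_residueField_linearMap_prod hM.subsingleton_hom hN.subsingleton_hom))
  have hxR := hx.of_prod_left
  have hxM := hx.of_prod_right.of_prod_left
  have hxN := hx.of_prod_right.of_prod_right
  obtain ⟨y, hym, hy⟩ := exists_isSMulRegular_of_subsingleton_residueField_linearMap
    (subsingleton_residueField_linearMap_prod (hR.subsingleton_hom_quotSMulTop hxR)
      (subsingleton_residueField_linearMap_prod (hM.subsingleton_hom_quotSMulTop hxM)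
        (hN.subsingleton_hom_quotSMulTop hxN)))
  exact ⟨x, hxm, y, hym, ⟨hxR, hy.of_prod_left⟩, ⟨hxM, hy.of_prod_right.of_prod_left⟩,
    ⟨hxN, hy.of_prod_right.of_prod_right⟩⟩

theorem two_le_localDepth_of_isSMulRegular [Nontrivial M] [Module.Finite R M]
    (hx : IsSMulRegular M x) (hxm : x ∈ maximalIdeal R)
    (hy : IsSMulRegular (QuotSMulTop x M) y) (hym : y ∈ maximalIdeal R) :
    2 ≤ localDepth R M := by
  have hm : ∀ r ∈ [x, y], r ∈ maximalIdeal R :=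
    List.forall_mem_cons.2 ⟨hxm, List.forall_mem_singleton.2 hym⟩
  exact le_iSup_of_le ⟨[x, y], hm, .of_isWeaklyRegular_of_mem_maximalIdeal _ hm
    (.cons hx ((RingTheory.Sequence.isWeaklyRegular_singleton_iff _ y).2 hy))⟩ le_rfl

theorem localDepth_le_of_ringKrullDim_le [IsNoetherianRing R] [Module.Finite R M] {d : ℕ∞}
    (hd : ringKrullDim R ≤ d) : localDepth R M ≤ d := by
  refine iSup_le fun ⟨rs, _, hreg⟩ ↦ WithBot.coe_le_coe.1 (le_trans ?_
    ((Module.supportDim_le_ringKrullDim R M).trans hd))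
  rw [← Module.supportDim_add_length_eq_supportDim_of_isRegular rs hreg]
  have : Nontrivial (M ⧸ Ideal.ofList rs • (⊤ : Submodule R M)) :=
    Submodule.Quotient.nontrivial_iff.2 hreg.top_ne_smul.symm
  obtain ⟨e, he⟩ := WithBot.ne_bot_iff_exists.1 (Module.supportDim_ne_bot_of_nontrivial R
    (M ⧸ Ideal.ofList rs • (⊤ : Submodule R M)))
  rw [← he]
  exact WithBot.coe_le_coe.2 le_add_self

theorem HasDepthGETwo.of_two_le_localDepth (h : 2 ≤ localDepth R M) : HasDepthGETwo R M := by
  obtain ⟨⟨rs, hm, hreg⟩, hlen⟩ := lt_iSup_iff.1 (lt_of_lt_of_le (by norm_num : (1 : ℕ∞) < 2) h)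
  match rs, hm, hreg, hlen with
  | [], _, _, hlen => simp at hlen
  | [_], _, _, hlen => simp at hlen
  | x :: y :: _, hm, hreg, _ =>
    rw [RingTheory.Sequence.isRegular_cons_iff, RingTheory.Sequence.isRegular_cons_iff] at hreg
    exact .of_isSMulRegular hreg.1 (hm x (by simp)) hreg.2.1 (hm y (by simp))

end DepthTwo

/-! ### Modules of finite injective dimension in dimension two -/

section FiniteInjectiveDimension

variable {R : Type u} [CommRing R] [IsLocalRing R] [IsNoetherianRing R]
  {M N : Type u} [AddCommGroup M] [Module R M] [Module.Finite R M]
  [AddCommGroup N] [Module R N] {x y : R}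

theorem isFiniteLength_quotSMulTop_quotSMulTop (hdim : ringKrullDim R = 2)
    (hx : IsSMulRegular R x) (hxm : x ∈ maximalIdeal R)
    (hy : IsSMulRegular (QuotSMulTop x R) y) (hym : y ∈ maximalIdeal R) :
    IsFiniteLength R (QuotSMulTop y (QuotSMulTop x M)) := by
  have hm : ∀ r ∈ [x, y], r ∈ maximalIdeal R :=
    List.forall_mem_cons.2 ⟨hxm, List.forall_mem_singleton.2 hym⟩
  have hreg : RingTheory.Sequence.IsRegular R [x, y] := .of_isWeaklyRegular_of_mem_maximalIdeal _ hm
    (.cons hx ((RingTheory.Sequence.isWeaklyRegular_singleton_iff _ y).2 hy))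
  have h0 := ringKrullDim_add_length_eq_ringKrullDim_of_isRegular _ hreg
  set J := Ideal.ofList [x, y] with hJ
  have : IsArtinianRing (R ⧸ J) := by
    rw [isArtinianRing_iff_krullDimLE_zero, Ring.KrullDimLE, Order.krullDimLE_iff]
    refine (ENat.WithBot.add_natCast_cancel (c := 2)).1 (h0.trans hdim) |>.le
  have hJM : Module.IsTorsionBySet R (QuotSMulTop y (QuotSMulTop x M)) (J : Set R) := by
    rw [Module.isTorsionBySet_iff_subset_annihilator]
    change J ≤ _
    rw [hJ, Ideal.ofList, Ideal.span_le]
    intro r hr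
    have hr : r = x ∨ r = y := by simpa using hr
    refine Module.mem_annihilator.2 fun n ↦ ?_
    rcases hr with rfl | rfl
    · exact smul_quotSMulTop_quotSMulTop_eq_zero _ _ n
    · exact smul_quotSMulTop_eq_zero _ n
  let := hJM.module
  have : IsScalarTower R (R ⧸ J) (QuotSMulTop y (QuotSMulTop x M)) := hJM.isScalarTower
  have := Module.Finite.of_restrictScalars_finite R (R ⧸ J) (QuotSMulTop y (QuotSMulTop x M))
  have : IsArtinian R (QuotSMulTop y (QuotSMulTop x M)) := by
    have : IsArtinian (R ⧸ J) (QuotSMulTop y (QuotSMulTop x M)) := inferInstance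
    exact isArtinian_of_surjective_algebraMap (Ideal.Quotient.mk_surjective (I := J))
  exact isFiniteLength_iff_isNoetherian_isArtinian.2 ⟨inferInstance, this⟩

/-- The module `R / (x, y)` is nonzero of finite length and, by its Koszul resolution, has
projective dimension at most two. -/
theorem subsingleton_ext_residueField_of_three_le (hdim : ringKrullDim R = 2)
    (hN : injectiveDimension (ModuleCat.of R N) < ⊤)
    (hx : IsSMulRegular R x) (hxm : x ∈ maximalIdeal R)
    (hy : IsSMulRegular (QuotSMulTop x R) y) (hym : y ∈ maximalIdeal R) (i : ℕ) (hi : 3 ≤ i) :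
    Subsingleton (Ext.{u} (ModuleCat.of R (ResidueField R)) (ModuleCat.of R N) i) := by
  have := nontrivial_quotSMulTop_of_mem_maximalIdeal R hxm
  have := nontrivial_quotSMulTop_of_mem_maximalIdeal (QuotSMulTop x R) hym
  refine subsingleton_ext_residueField_of_injectiveDimension_lt_top hN
    (isFiniteLength_quotSMulTop_quotSMulTop (M := R) hdim hx hxm hy hym) (fun i hi ↦ ?_) i hi
  obtain ⟨i, rfl⟩ := Nat.exists_eq_add_of_le' hi
  have h (j : ℕ) : Subsingleton (Ext.{u} (ModuleCat.of R R) (ModuleCat.of R N) (j + 1)) :=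
    Ext.subsingleton_of_projective _ _ j
  exact subsingleton_ext_quotSMulTop_left hy
    (subsingleton_ext_quotSMulTop_left hx (h i) (h (i + 1)))
    (subsingleton_ext_quotSMulTop_left hx (h (i + 1)) (h (i + 2)))

/-- Both sides are the length of `Ext²(R / (x, y), N)`. -/
theorem length_quotSMulTop_quotSMulTop_eq_mul (hdim : ringKrullDim R = 2)
    (hid : injectiveDimension (ModuleCat.of R N) < ⊤) (hN : HasDepthGETwo R N)
    (hx : IsSMulRegular R x) (hxm : x ∈ maximalIdeal R)
    (hy : IsSMulRegular (QuotSMulTop x R) y) (hym : y ∈ maximalIdeal R)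
    (hxN : IsSMulRegular N x) (hyN : IsSMulRegular (QuotSMulTop x N) y) :
    Module.length R (QuotSMulTop y (QuotSMulTop x N)) =
      Module.length R (QuotSMulTop y (QuotSMulTop x R)) * Module.length R
        (Ext.{u} (ModuleCat.of R (ResidueField R)) (ModuleCat.of R N) 2) := by
  have hlen := isFiniteLength_quotSMulTop_quotSMulTop (M := R) hdim hx hxm hy hym
  rw [← length_ext_of_isFiniteLength hN.subsingleton_ext_one
    (subsingleton_ext_residueField_of_three_le hdim hid hx hxm hy hym 3 le_rfl) hlen,
    ← (LinearEquiv.ofBijective _ ⟨homToExtTwo_injective hxN hyN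
      (subsingleton_ext_of_isFiniteLength hN.subsingleton_ext_zero hlen)
      (subsingleton_ext_of_isFiniteLength hN.subsingleton_ext_one hlen),
      homToExtTwo_surjective hxN hyN (smul_quotSMulTop_quotSMulTop_eq_zero x y)
        (smul_quotSMulTop_eq_zero y)⟩).length_eq]
  exact (homQuotSMulTopEquiv (smul_quotSMulTop_quotSMulTop_eq_zero x y)
    (smul_quotSMulTop_eq_zero y)).length_eq.symm

/-- Modules of type one have isomorphic reductions modulo `x, y`: a map between the simple socles
extends, as `N / (x, y)N` is injective with respect to modules killed by `x, y`; the extension is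
injective because it is so on the socle, and the two lengths are equal. -/
theorem exists_surjective_quotSMulTop_quotSMulTop [Module.Finite R N]
    (hdim : ringKrullDim R = 2)
    (hM : HasDepthGETwo R M) (hN : HasDepthGETwo R N)
    (hidM : injectiveDimension (ModuleCat.of R M) < ⊤)
    (hidN : injectiveDimension (ModuleCat.of R N) < ⊤)
    (htM : Module.length R
      (Ext.{u} (ModuleCat.of R (ResidueField R)) (ModuleCat.of R M) 2) = 1)
    (htN : Module.length R
      (Ext.{u} (ModuleCat.of R (ResidueField R)) (ModuleCat.of R N) 2) = 1)
    (hx : IsSMulRegular R x) (hxm : x ∈ maximalIdeal R)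
    (hy : IsSMulRegular (QuotSMulTop x R) y) (hym : y ∈ maximalIdeal R)
    (hxM : IsSMulRegular M x) (hyM : IsSMulRegular (QuotSMulTop x M) y)
    (hxN : IsSMulRegular N x) (hyN : IsSMulRegular (QuotSMulTop x N) y) :
    ∃ g : QuotSMulTop y (QuotSMulTop x M) →ₗ[R] QuotSMulTop y (QuotSMulTop x N),
      Function.Surjective g := by
  have hlM := length_quotSMulTop_quotSMulTop_eq_mul hdim hidM hM hx hxm hy hym hxM hyM
  have hlN := length_quotSMulTop_quotSMulTop_eq_mul hdim hidN hN hx hxm hy hym hxN hyN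
  rw [htM, mul_one] at hlM
  rw [htN, mul_one] at hlN
  have hfM := isFiniteLength_quotSMulTop_quotSMulTop (M := M) hdim hx hxm hy hym
  have hfN := isFiniteLength_quotSMulTop_quotSMulTop (M := N) hdim hx hxm hy hym
  have := nontrivial_quotSMulTop_of_mem_maximalIdeal R hxm
  have := nontrivial_quotSMulTop_of_mem_maximalIdeal (QuotSMulTop x R) hym
  have : Nontrivial (QuotSMulTop y (QuotSMulTop x M)) := by
    rw [← Module.length_pos_iff (R := R), hlM]; exact Module.length_pos
  have : Nontrivial (QuotSMulTop y (QuotSMulTop x N)) := by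
    rw [← Module.length_pos_iff (R := R), hlN]; exact Module.length_pos
  obtain ⟨ι, hι⟩ := exists_injective_residueField hfM
  obtain ⟨f, hf⟩ := exists_injective_residueField hfN
  have hkx := smul_residueField_eq_zero hxm
  have hky := smul_residueField_eq_zero hym
  have hinjM := homToExtTwo_injective hxM hyM hM.subsingleton_ext_zero hM.subsingleton_ext_one
  have hinjN := homToExtTwo_injective hxN hyN hN.subsingleton_ext_zero hN.subsingleton_ext_one
  obtain ⟨g, hg⟩ : ∃ g, g ∘ₗ ι = f := by
    obtain ⟨e, he⟩ := extPrecomp_surjective hι (LinearMap.range ι).mkQ_surjective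
      (LinearMap.exact_map_mkQ_range ι) (subsingleton_ext_of_isFiniteLength
        (subsingleton_ext_residueField_of_three_le hdim hidN hx hxm hy hym 3 le_rfl)
        (hfM.of_surjective (Submodule.mkQ_surjective _))) (homToExtTwo _ hxN hyN f)
    obtain ⟨g, rfl⟩ := homToExtTwo_surjective hxN hyN (smul_quotSMulTop_quotSMulTop_eq_zero x y)
      (smul_quotSMulTop_eq_zero y) e
    exact ⟨g, hinjN ((homToExtTwo_comp ι hxN hyN g).trans he)⟩
  -- A nonzero kernel of `g` contains a copy of `k`, hence the simple socle, where `g` is injective.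
  have hgi : Function.Injective g := by
    rw [← LinearMap.ker_eq_bot, ← Submodule.subsingleton_iff_eq_bot]
    by_contra hker
    rw [not_subsingleton_iff_nontrivial] at hker
    obtain ⟨κ, hκ⟩ := exists_injective_residueField
      (hfM.of_injective (LinearMap.ker g).injective_subtype)
    have hsimple : IsSimpleModule R
        (ResidueField R →ₗ[R] QuotSMulTop y (QuotSMulTop x M)) := by
      rw [← Module.length_eq_one_iff, ← htM]
      exact (LinearEquiv.ofBijective _ ⟨hinjM, homToExtTwo_surjective hxM hyM hkx hky⟩).length_eq
    have hι0 : ι ≠ 0 := by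
      rintro rfl
      exact one_ne_zero (hι (a₁ := 1) (a₂ := 0) rfl)
    obtain ⟨r, hr⟩ := IsSimpleModule.toSpanSingleton_surjective R hι0
      ((LinearMap.ker g).subtype ∘ₗ κ)
    have hr1 : ι (r • 1) = κ 1 := by
      rw [map_smul]; exact LinearMap.congr_fun hr 1
    have hr0 : r • (1 : ResidueField R) = 0 := hf <| by
      rw [← hg, LinearMap.comp_apply, hr1, map_zero]
      exact (κ 1).2
    rw [hr0, map_zero] at hr1
    exact one_ne_zero (hκ (a₁ := 1) (a₂ := 0) (by
      rw [map_zero]; exact Subtype.ext hr1.symm))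
  refine ⟨g, LinearMap.range_eq_top.1 ?_⟩
  by_contra hne
  obtain ⟨_, _⟩ := isFiniteLength_iff_isNoetherian_isArtinian.1 hfN
  have := Submodule.length_lt hne
  rw [← (LinearEquiv.ofInjective g hgi).length_eq, hlM, hlN] at this
  exact this.false

/-- A surjection `M / (x, y)M → N / (x, y)N` lifts to a map `M → N`, since `Ext¹ M N` and `Ext² M N`
vanish; by Nakayama's lemma the lift is surjective. -/
theorem exists_surjective_of_length_ext_two_eq_one [Module.Finite R N]
    (hdim : ringKrullDim R = 2)
    (hM : HasDepthGETwo R M) (hN : HasDepthGETwo R N)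
    (hidM : injectiveDimension (ModuleCat.of R M) < ⊤)
    (hidN : injectiveDimension (ModuleCat.of R N) < ⊤)
    (htM : Module.length R
      (Ext.{u} (ModuleCat.of R (ResidueField R)) (ModuleCat.of R M) 2) = 1)
    (htN : Module.length R
      (Ext.{u} (ModuleCat.of R (ResidueField R)) (ModuleCat.of R N) 2) = 1)
    (hx : IsSMulRegular R x) (hxm : x ∈ maximalIdeal R)
    (hy : IsSMulRegular (QuotSMulTop x R) y) (hym : y ∈ maximalIdeal R)
    (hxM : IsSMulRegular M x) (hyM : IsSMulRegular (QuotSMulTop x M) y)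
    (hxN : IsSMulRegular N x) (hyN : IsSMulRegular (QuotSMulTop x N) y) :
    ∃ h : M →ₗ[R] N, Function.Surjective h := by
  obtain ⟨g, hg⟩ := exists_surjective_quotSMulTop_quotSMulTop hdim hM hN hidM hidN htM htN
    hx hxm hy hym hxM hyM hxN hyN
  have hext (i : ℕ) : Subsingleton (Ext.{u} (ModuleCat.of R M) (ModuleCat.of R N) (i + 1)) :=
    subsingleton_ext_of_quotSMulTop_left hxM hxm (subsingleton_ext_of_quotSMulTop_left hyM hym
      (subsingleton_ext_of_isFiniteLength
        (subsingleton_ext_residueField_of_three_le hdim hidN hx hxm hy hym _ (by lia))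
        (isFiniteLength_quotSMulTop_quotSMulTop hdim hx hxm hy hym)))
  obtain ⟨ψ, hψ⟩ := exists_mkQ_comp_eq hyN
    (subsingleton_ext_quotSMulTop_right hxN (hext 0) (hext 1))
    (g ∘ₗ (y • (⊤ : Submodule R (QuotSMulTop x M))).mkQ ∘ₗ (x • (⊤ : Submodule R M)).mkQ)
  obtain ⟨h, rfl⟩ := exists_mkQ_comp_eq hxN (hext 0) ψ
  refine ⟨h, LinearMap.range_eq_top.1 (top_le_iff.1 ?_)⟩
  refine Submodule.le_of_le_smul_of_le_jacobson_bot (I := maximalIdeal R)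
    (Module.finite_def.1 inferInstance) (maximalIdeal_le_jacobson _) fun n _ ↦ ?_
  obtain ⟨m, hm⟩ := (hg.comp ((Submodule.mkQ_surjective _).comp (Submodule.mkQ_surjective _)))
    (Submodule.Quotient.mk (Submodule.Quotient.mk n))
  replace hm := (LinearMap.congr_fun hψ m).trans hm
  obtain ⟨c, -, hc⟩ := (Submodule.Quotient.eq _).1 hm
  induction c using Submodule.Quotient.induction_on with | _ c
  obtain ⟨d, -, hd⟩ := (Submodule.Quotient.eq _).1 hc
  have hd : x • d = y • c - (h m - n) := hd
  rw [show n = h m + (x • d - y • c) by rw [hd]; abel]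
  exact Submodule.add_mem_sup ⟨m, rfl⟩ (Submodule.sub_mem _
    (Submodule.smul_mem_smul hxm trivial) (Submodule.smul_mem_smul hym trivial))

theorem nonempty_linearEquiv_of_length_ext_two_eq_one [Module.Finite R N]
    (hdim : ringKrullDim R = 2)
    (hR : HasDepthGETwo R R) (hM : HasDepthGETwo R M) (hN : HasDepthGETwo R N)
    (hidM : injectiveDimension (ModuleCat.of R M) < ⊤)
    (hidN : injectiveDimension (ModuleCat.of R N) < ⊤)
    (htM : Module.length R
      (Ext.{u} (ModuleCat.of R (ResidueField R)) (ModuleCat.of R M) 2) = 1)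
    (htN : Module.length R
      (Ext.{u} (ModuleCat.of R (ResidueField R)) (ModuleCat.of R N) 2) = 1) :
    Nonempty (M ≃ₗ[R] N) := by
  obtain ⟨x, hxm, y, hym, ⟨hx, hy⟩, ⟨hxM, hyM⟩, hxN, hyN⟩ := hR.exists_isSMulRegular hM hN
  obtain ⟨f, hf⟩ := exists_surjective_of_length_ext_two_eq_one hdim hM hN hidM hidN htM htN
    hx hxm hy hym hxM hyM hxN hyN
  obtain ⟨g, hg⟩ := exists_surjective_of_length_ext_two_eq_one hdim hN hM hidN hidM htN htM
    hx hxm hy hym hxN hyN hxM hyM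
  have hinj := IsNoetherian.injective_of_surjective_endomorphism (g ∘ₗ f) (hg.comp hf)
  exact ⟨LinearEquiv.ofBijective f ⟨Function.Injective.of_comp (f := g) hinj, hf⟩⟩

end FiniteInjectiveDimension

/-! ### Reflexive ideals of finite injective dimension -/

theorem mainTheorem5 (R : Type u) [CommRing R] [IsDomain R] [IsNoetherianRing R] [IsLocalRing R]
    (hR : IsAnalyticallyNormal R) (hdim : ringKrullDim R = 2)
    (I : Ideal R) (hI0 : I ≠ ⊥) (hI : Module.IsReflexive R I)
    (hid : injectiveDimension (ModuleCat.of R I) < ⊤) :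
    (∃ (ω : Type u) (_ : AddCommGroup ω) (_ : Module R ω),
        IsCanonicalModule R ω ∧ Nonempty (I ≃ₗ[R] ω)) ∧
      ∀ (ω : Type u) [AddCommGroup ω] [Module R ω],
        IsCanonicalModule R ω → Nonempty (I ≃ₗ[R] ω) := by
  have := hR.isIntegrallyClosed
  have hm0 : maximalIdeal R ≠ ⊥ := by
    intro h0
    rw [← maximalIdeal_height_eq_ringKrullDim, h0, Ideal.height_bot] at hdim
    exact absurd hdim (by decide)
  obtain ⟨a, haI, ha⟩ := Submodule.exists_mem_ne_zero_of_ne_bot hI0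
  obtain ⟨b, hbm, hb⟩ := Submodule.exists_mem_ne_zero_of_ne_bot hm0
  -- Taking `x` in `I` makes the kernel and cokernel of `I / xI → R / xR` isomorphic to `R / I`.
  obtain ⟨x, hx0, hxI, hxm⟩ : ∃ x, x ≠ 0 ∧ x ∈ I ∧ x ∈ maximalIdeal R :=
    ⟨a * b, mul_ne_zero ha hb, I.mul_mem_right b haI, Ideal.mul_mem_left _ a hbm⟩
  have hsR := subsingleton_residueField_linearMap_quotSMulTop_self
    (hdim ▸ by decide : 1 < ringKrullDim R) hx0
  have hsI := subsingleton_residueField_linearMap_quotSMulTop_of_isReflexive (M := I) hx0 hsR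
  have hxR : IsSMulRegular R x := fun r s h ↦ mul_left_cancel₀ hx0 h
  have hxrI : IsSMulRegular I x := fun r s h ↦
    Subtype.ext (mul_left_cancel₀ hx0 (congrArg Subtype.val h))
  obtain ⟨y, hym, hy⟩ := exists_isSMulRegular_of_subsingleton_residueField_linearMap
    (subsingleton_residueField_linearMap_prod hsR (subsingleton_residueField_linearMap_prod hsI
      (subsingleton_residueField_linearMap_quotient_ideal hx0 hxI hsI)))
  have hyR := hy.of_prod_left
  have hyI := hy.of_prod_right.of_prod_left
  have hRd : HasDepthGETwo R R := .of_isSMulRegular hxR hxm hyR hym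
  have hId : HasDepthGETwo R I := .of_isSMulRegular hxrI hxm hyI hym
  have htI : Module.length R
      (Ext.{u} (ModuleCat.of R (ResidueField R)) (ModuleCat.of R I) 2) = 1 := by
    have hl := length_quotSMulTop_quotSMulTop_eq_mul hdim hid hId hxR hxm hyR hym hxrI hyI
    rw [length_quotSMulTop_quotSMulTop_ideal hx0 hxI hyR hy.of_prod_right.of_prod_right] at hl
    have := nontrivial_quotSMulTop_of_mem_maximalIdeal R hxm
    have := nontrivial_quotSMulTop_of_mem_maximalIdeal (QuotSMulTop x R) hym
    have hfin := Module.length_ne_top_iff.2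
      (isFiniteLength_quotSMulTop_quotSMulTop (M := R) hdim hxR hxm hyR hym)
    have hpos := (Module.length_pos (R := R) (M := QuotSMulTop y (QuotSMulTop x R))).ne'
    exact (ENat.mul_left_strictMono hpos hfin).injective
      ((mul_comm _ _).trans (hl.symm.trans (one_mul _).symm))
  have hnt : Nontrivial I := Submodule.nontrivial_iff_ne_bot.2 hI0
  have hdepth : localDepth R I = 2 :=
    le_antisymm (localDepth_le_of_ringKrullDim_le hdim.le)
      (two_le_localDepth_of_isSMulRegular hxrI hxm hyI hym)
  refine ⟨⟨I, inferInstance, inferInstance, ⟨⟨inferInstance, hnt, ?_⟩, ?_, hid⟩,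
    ⟨LinearEquiv.refl R I⟩⟩, fun ω _ _ hω ↦ ?_⟩
  · rw [hdepth, hdim]; rfl
  · rw [cohenMacaulayType, hdepth]; exact htI
  · have := hω.isMaximalCohenMacaulay.finite
    have hdω : localDepth R ω = 2 :=
      WithBot.coe_injective (hω.isMaximalCohenMacaulay.depth_eq.trans hdim)
    have htω := hω.type_eq_one
    rw [cohenMacaulayType, hdω] at htω
    exact nonempty_linearEquiv_of_length_ext_two_eq_one hdim hRd hId
      (.of_two_le_localDepth hdω.ge) hid hω.injectiveDimension_lt_top htI htω
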